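/- Let $d\in\mathbb N$. A norm $\|\cdot\|_D$ on $\mathbb R^d$ is called a $D$-norm if there is a random vector $\mathbf Z=(Z_1,\dots,Z_d)$ with $Z_i\ge 0$ almost surely and $E(Z_i)=1$ for $1\le i\le d$, such that $$\|\mathbf x\|_D=E\Big(\max_{1\le i\le d}|x_i|\,Z_i\Big),\qquad \mathbf x\in\mathbb R^d;$$ such a $\mathbf Z$ is called a generator of $\|\cdot\|_D$. For two $D$-norms $\|\cdot\|_{D},\|\cdot\|_{D'}$ on $\mathbb R^d$ put $$d_W\big(\|\cdot\|_{D},\|\cdot\|_{D'}\big):=\inf E\big(\|\mathbf Z-\mathbf Z'\|_1\big),$$ where the infimum is taken over all pairs $(\mathbf Z,\mathbf Z')$ of random vectors, defined on a common probability space, such that $\mathbf Z$ generates $\|\cdot\|_{D}$, $\mathbf Z'$ generates $\|\cdot\|_{D'}$, and $\|\mathbf Z\|_1=\|\mathbf Z'\|_1=d$ almost surely. Lemma. Let $\|\cdot\|_{D_n}$, $n\in\mathbb N\cup\{0\}$, be a sequence of $D$-norms on $\mathbb R^d$, and for each $n$ let $\mathbf Z^{(n)}$ be a generator of $\|\cdot\|_{D_n}$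 with $\|\mathbf Z^{(n)}\|_1=d$ almost surely (the $\mathbf Z^{(n)}$ may be defined on different probability spaces). Then $$d_W\big(\|\cdot\|_{D_n},\|\cdot\|_{D_0}\big)\xrightarrow[n\to\infty]{}0\iff \mathbf Z^{(n)}\to \mathbf Z^{(0)}\ \text{in distribution as } n\to\infty .$$ -/

import Mathlib

open MeasureTheory ProbabilityTheory Filter Topology

/-- `Z` is a generator of the function `N` on `ℝ^d`: `Z` is a random vector with `Z_i ≥ 0` almost
surely and `E(Z_i) = 1`, and `N x = E(max_i |x_i| Z_i) = E(‖x Z‖_∞)` for all `x`. The norm on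
`Fin d → ℝ` is the sup-norm, and `x * Z ω` is the componentwise product. A Bochner integral equal
to `1` is that of an integrable function, so the expectations are genuine. -/
structure IsGenerator {d : ℕ} (N : (Fin d → ℝ) → ℝ) {Ω : Type*} [MeasurableSpace Ω]
    (P : Measure Ω) (Z : Ω → Fin d → ℝ) : Prop where
  aemeasurable : AEMeasurable Z P
  nonneg : ∀ᵐ ω ∂P, ∀ i, 0 ≤ Z ω i
  expectation_eq_one : ∀ i, ∫ ω, Z ω i ∂P = 1
  norm_eq : ∀ x : Fin d → ℝ, N x = ∫ ω, ‖x * Z ω‖ ∂P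

/-- A generator that satisfies in addition `‖Z‖₁ = d` almost surely. -/
structure IsNormalizedGenerator {d : ℕ} (N : (Fin d → ℝ) → ℝ) {Ω : Type*} [MeasurableSpace Ω]
    (P : Measure Ω) (Z : Ω → Fin d → ℝ) : Prop extends IsGenerator N P Z where
  l1_eq : ∀ᵐ ω ∂P, ∑ i, |Z ω i| = (d : ℝ)

/-- `D`-norms on `ℝ^d`: norms (definite seminorms) that admit a generator. Every generator can be
realized on `ℝ^d` with its own law, so probability spaces in `Type` suffice. -/
structure DNorm (d : ℕ) extends Seminorm ℝ (Fin d → ℝ) where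
  eq_zero_of_apply_eq_zero : ∀ x, toSeminorm x = 0 → x = 0
  exists_generator : ∃ (Ω : Type) (_ : MeasurableSpace Ω) (P : Measure Ω)
    (_ : IsProbabilityMeasure P) (Z : Ω → Fin d → ℝ), IsGenerator toSeminorm P Z

/-- The distance `d_W` of two `D`-norms: the infimum of `E(‖Z₁ - Z₂‖₁)` over all pairs of
generators `Z₁`, `Z₂` of the two norms that live on a common probability space and satisfy
`‖Z₁‖₁ = ‖Z₂‖₁ = d`. Every such pair can be realized on `ℝ^d × ℝ^d` with its joint law, so
probability spaces in `Type` suffice. -/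
noncomputable def DNorm.dW {d : ℕ} (N₁ N₂ : DNorm d) : ℝ :=
  sInf {r : ℝ | ∃ (Ω : Type) (_ : MeasurableSpace Ω) (P : Measure Ω) (_ : IsProbabilityMeasure P)
    (Z₁ Z₂ : Ω → Fin d → ℝ),
    IsNormalizedGenerator N₁.toSeminorm P Z₁ ∧ IsNormalizedGenerator N₂.toSeminorm P Z₂ ∧
      r = ∫ ω, ∑ i, |Z₁ ω i - Z₂ ω i| ∂P}

/-! A `D`-norm determines the law of its normalized generators (`IsNormalizedGenerator.map_eq`), so
`DNorm.dW` is the Wasserstein-1 distance, with ℓ¹ cost, between two laws on a compact simplex.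
There, Wasserstein convergence and weak convergence coincide.

Uniqueness of the law: the values `E‖x Z‖` are the masses that the exponent measure gives to the
sets `{∃ i, 1 ≤ x i * y i}`. These fix it on a π-system away from the origin, and its radial
structure gives back the law (`measure_eq_of_lintegral_norm_mul_eq`).

From `dW` to weak convergence: by uniqueness every admissible pair couples the two given laws, hence
expectations of an `L`-Lipschitz function differ by at most `L * dW`, and bounded Lipschitz
functions test weak convergence.

Conversely, any coupling of the two laws is an admissible pair. A fine partition of unity cuts both
laws into small pieces. Mass is coupled within pieces as far as possible, at small cost. The
leftover mass vanishes under weak convergence and travels at most the diameter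
(`exists_coupling_lintegral_edist_le`). -/

/-! ### Exponent measures and uniqueness of the law. -/

/-- The image of `μ ⊗ du` on `ℝ^d × (0, ∞)` under `(z, u) ↦ z / u`. For the law `μ` of a generator
of a `D`-norm, this is the exponent measure of the associated max-stable distribution. -/
noncomputable def exponentMeasure {d : ℕ} (μ : Measure (Fin d → ℝ)) : Measure (Fin d → ℝ) :=
  (μ.prod (volume.restrict (Set.Ioi (0 : ℝ)))).map (fun p => p.2⁻¹ • p.1)

lemma exponentMeasure_apply {d : ℕ} (μ : Measure (Fin d → ℝ)) [SFinite μ] {s : Set (Fin d → ℝ)}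
    (hs : MeasurableSet s) :
    exponentMeasure μ s = ∫⁻ z, volume ({u : ℝ | u⁻¹ • z ∈ s} ∩ Set.Ioi 0) ∂μ := by
  have hm : Measurable (fun p : (Fin d → ℝ) × ℝ => p.2⁻¹ • p.1) := by fun_prop
  rw [exponentMeasure, Measure.map_apply hm hs, Measure.prod_apply (hm hs)]
  refine lintegral_congr fun z => ?_
  rw [Measure.restrict_apply (measurable_prodMk_left (hm hs))]
  rfl

lemma measurableSet_exists_one_le_mul {d : ℕ} (x : Fin d → ℝ) :
    MeasurableSet {y : Fin d → ℝ | ∃ i, 1 ≤ x i * y i} := by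
  rw [Set.ofPred_exists]
  exact MeasurableSet.iUnion fun i => measurableSet_le (by fun_prop) (by fun_prop)

lemma exists_one_le_mul_inv_smul_iff {d : ℕ} {x z : Fin d → ℝ} (hx : ∀ i, 0 ≤ x i)
    (hz : ∀ i, 0 ≤ z i) {u : ℝ} (hu : 0 < u) :
    (∃ i, 1 ≤ x i * (u⁻¹ • z) i) ↔ u ≤ ‖x * z‖ := by
  rw [← not_iff_not, not_le, pi_norm_lt_iff hu]
  push Not
  refine forall_congr' fun i => ?_
  rw [Pi.mul_apply, Real.norm_of_nonneg (mul_nonneg (hx i) (hz i)), Pi.smul_apply, smul_eq_mul,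
    mul_left_comm, inv_mul_lt_one₀ hu]

/-- For fixed `z ≥ 0`, the `u > 0` with `z / u` in the set form the interval `(0, ‖x * z‖]`. -/
lemma exponentMeasure_exists_one_le_mul {d : ℕ} (μ : Measure (Fin d → ℝ)) [SFinite μ]
    (hμ : ∀ᵐ z ∂μ, ∀ i, 0 ≤ z i) {x : Fin d → ℝ} (hx : ∀ i, 0 ≤ x i) :
    exponentMeasure μ {y | ∃ i, 1 ≤ x i * y i} = ∫⁻ z, ENNReal.ofReal ‖x * z‖ ∂μ := by
  rw [exponentMeasure_apply μ (measurableSet_exists_one_le_mul x)]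
  refine lintegral_congr_ae ?_
  filter_upwards [hμ] with z hz
  have : {u : ℝ | u⁻¹ • z ∈ {y : Fin d → ℝ | ∃ i, 1 ≤ x i * y i}} ∩ Set.Ioi 0
      = Set.Ioc 0 ‖x * z‖ := by
    ext u
    simp only [Set.mem_inter_iff, Set.mem_ofPred_eq, Set.mem_Ioi, Set.mem_Ioc]
    rw [and_comm]
    exact and_congr_right fun hu => exists_one_le_mul_inv_smul_iff hx hz hu
  refine (congrArg volume this).trans ?_
  rw [Real.volume_Ioc, sub_zero]

lemma exponentMeasure_apply_lt_zero {d : ℕ} (μ : Measure (Fin d → ℝ)) [SFinite μ]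
    (hμ : ∀ᵐ z ∂μ, ∀ i, 0 ≤ z i) (i : Fin d) :
    exponentMeasure μ {y | y i < 0} = 0 := by
  rw [exponentMeasure_apply μ (measurableSet_lt (by fun_prop) (by fun_prop))]
  rw [← lintegral_zero (μ := μ)]
  refine lintegral_congr_ae ?_
  filter_upwards [hμ] with z hz
  have : {u : ℝ | u⁻¹ • z ∈ {y : Fin d → ℝ | y i < 0}} ∩ Set.Ioi 0 = ∅ := by
    ext u
    simp only [Set.mem_inter_iff, Set.mem_ofPred_eq, Set.mem_Ioi, Set.mem_empty_iff_false, iff_false,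
      not_and, not_lt, Pi.smul_apply, smul_eq_mul]
    intro h
    by_contra! hu
    exact absurd (mul_nonneg (inv_nonneg.2 hu.le) (hz i)) (not_le.2 h)
  exact (congrArg volume this).trans measure_empty

/-- The coordinates of `z / u` sum to `d / u`, which exceeds 1 iff `u < d`, and rescaling the sum to
`d` returns `z`. Each `z ∈ A` thus contributes an interval of length `d`. -/
lemma exponentMeasure_radial {d : ℕ} (μ : Measure (Fin d → ℝ)) [SFinite μ]
    (hμ : ∀ᵐ z ∂μ, ∑ i, z i = (d : ℝ)) {A : Set (Fin d → ℝ)} (hA : MeasurableSet A) :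
    exponentMeasure μ {y | 1 < ∑ i, y i ∧ ((d : ℝ) / ∑ i, y i) • y ∈ A} = d * μ A := by
  have hmeas : MeasurableSet {y : Fin d → ℝ | 1 < ∑ i, y i ∧ ((d : ℝ) / ∑ i, y i) • y ∈ A} := by
    have h : Measurable (fun y : Fin d → ℝ => ((d : ℝ) / ∑ i, y i) • y) := by fun_prop
    have h' : MeasurableSet {y : Fin d → ℝ | 1 < ∑ i, y i} :=
      measurableSet_lt (by fun_prop) (by fun_prop)
    exact h'.inter (h hA)
  rw [exponentMeasure_apply μ hmeas, ← lintegral_indicator_const hA]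
  refine lintegral_congr_ae ?_
  filter_upwards [hμ] with z hz
  have key : ∀ u : ℝ, 0 < u → ((1 < ∑ i, (u⁻¹ • z) i ∧
      ((d : ℝ) / ∑ i, (u⁻¹ • z) i) • (u⁻¹ • z) ∈ A) ↔ (u < d ∧ z ∈ A)) := by
    intro u hu
    have hs : ∑ i, (u⁻¹ • z) i = u⁻¹ * d := by
      simp only [Pi.smul_apply, smul_eq_mul]
      rw [← Finset.mul_sum, hz]
    rw [hs, one_lt_inv_mul₀ hu]
    refine and_congr_right fun hd => ?_
    have hd0 : (d : ℝ) ≠ 0 := (hu.trans hd).ne'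
    have : ((d : ℝ) / (u⁻¹ * d)) • (u⁻¹ • z) = z := by
      rw [smul_smul]
      have : (d : ℝ) / (u⁻¹ * d) * u⁻¹ = 1 := by field_simp
      rw [this, one_smul]
    rw [this]
  by_cases hzA : z ∈ A
  · have : {u : ℝ | u⁻¹ • z ∈ {y : Fin d → ℝ | 1 < ∑ i, y i ∧ ((d : ℝ) / ∑ i, y i) • y ∈ A}}
        ∩ Set.Ioi 0 = Set.Ioo 0 (d : ℝ) := by
      ext u
      simp only [Set.mem_inter_iff, Set.mem_ofPred_eq, Set.mem_Ioi, Set.mem_Ioo]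
      rw [and_comm]
      refine and_congr_right fun hu => ?_
      rw [key u hu]
      simp [hzA]
    refine (congrArg volume this).trans ?_
    rw [Set.indicator_of_mem hzA, Real.volume_Ioo, sub_zero, ENNReal.ofReal_natCast]
  · have : {u : ℝ | u⁻¹ • z ∈ {y : Fin d → ℝ | 1 < ∑ i, y i ∧ ((d : ℝ) / ∑ i, y i) • y ∈ A}}
        ∩ Set.Ioi 0 = ∅ := by
      ext u
      simp only [Set.mem_inter_iff, Set.mem_ofPred_eq, Set.mem_Ioi, Set.mem_empty_iff_false,
        iff_false]
      rintro ⟨h, hu⟩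
      exact hzA ((key u hu).1 h).2
    refine (congrArg volume this).trans ?_
    rw [Set.indicator_of_notMem hzA, measure_empty]

lemma isCountablySpanning_range_Iio : IsCountablySpanning (Set.range (Set.Iio : ℝ → Set ℝ)) := by
  refine ⟨fun n : ℕ => Set.Iio (n : ℝ), fun n => ⟨n, rfl⟩, ?_⟩
  ext x
  simpa using exists_nat_gt x

/-- The functional `x ↦ E‖x Z‖_∞` determines the law of `Z` among the laws on the simplex
`{z ≥ 0, ‖z‖₁ = d}`. -/
theorem measure_eq_of_lintegral_norm_mul_eq {d : ℕ} {μ ν : Measure (Fin d → ℝ)}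
    [IsProbabilityMeasure μ] [IsProbabilityMeasure ν]
    (hμ : ∀ᵐ z ∂μ, ∀ i, 0 ≤ z i) (hν : ∀ᵐ z ∂ν, ∀ i, 0 ≤ z i)
    (hμd : ∀ᵐ z ∂μ, ∑ i, z i = (d : ℝ)) (hνd : ∀ᵐ z ∂ν, ∑ i, z i = (d : ℝ))
    (hfin : ∀ x : Fin d → ℝ, ∫⁻ z, ENNReal.ofReal ‖x * z‖ ∂μ ≠ ⊤)
    (h : ∀ x : Fin d → ℝ, ∫⁻ z, ENNReal.ofReal ‖x * z‖ ∂μ = ∫⁻ z, ENNReal.ofReal ‖x * z‖ ∂ν) :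
    μ = ν := by
  rcases Nat.eq_zero_or_pos d with rfl | hd
  · ext s -
    rcases Set.eq_empty_or_nonempty s with rfl | ⟨x, hx⟩
    · simp
    · have : s = Set.univ := Set.eq_univ_of_forall fun y => by rwa [Subsingleton.elim y x]
      simp [this]
  have hd' : (0 : ℝ) < d := by exact_mod_cast hd
  -- The threshold `1 / d` makes `B` contain every `y` with coordinate sum above 1, while its
  -- exponent measure stays finite.
  set B : Set (Fin d → ℝ) := {y | ∃ i, 1 ≤ (fun _ => (d : ℝ)) i * y i} with hB
  have hBμ := exponentMeasure_exists_one_le_mul μ hμ (x := fun _ => (d : ℝ)) fun _ => hd'.le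
  have hBν := exponentMeasure_exists_one_le_mul ν hν (x := fun _ => (d : ℝ)) fun _ => hd'.le
  have hrestr : (exponentMeasure μ).restrict B = (exponentMeasure ν).restrict B := by
    have hfm : IsFiniteMeasure ((exponentMeasure μ).restrict B) := by
      refine ⟨?_⟩
      rw [Measure.restrict_apply_univ, hBμ]
      exact (hfin _).lt_top
    refine ext_of_generate_finite
      (Set.univ.pi '' Set.univ.pi fun _ : Fin d => Set.range (Set.Iio : ℝ → Set ℝ)) ?_ ?_ ?_ ?_
    · symm
      refine generateFrom_eq_pi (fun _ => ?_) (fun _ => isCountablySpanning_range_Iio)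
      rw [← borel_eq_generateFrom_Iio]
      exact (BorelSpace.measurable_eq).symm
    · refine IsPiSystem.pi fun _ => ?_
      rintro _ ⟨a, rfl⟩ _ ⟨b, rfl⟩ -
      exact ⟨min a b, Set.Iio_inter_Iio.symm⟩
    · rintro _ ⟨S, hS, rfl⟩
      choose t ht using fun i => hS i (Set.mem_univ i)
      obtain rfl : (fun i => Set.Iio (t i)) = S := funext ht
      have hTm : MeasurableSet (Set.univ.pi fun i => Set.Iio (t i)) :=
        MeasurableSet.univ_pi fun i => measurableSet_Iio
      by_cases ht0 : ∀ i, 0 < t i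
      -- With `C` the complement of the orthant, this is `B \ C = (B ∪ C) \ C`. The union has the
      -- same shape, with coefficients `max d (t i)⁻¹`, so both masses are values of the functional.
      · have hset : (Set.univ.pi fun i => Set.Iio (t i)) ∩ B =
            {y | ∃ i, 1 ≤ max (d : ℝ) (t i)⁻¹ * y i} \ {y | ∃ i, 1 ≤ (t i)⁻¹ * y i} := by
          ext y
          have e1 : y ∈ (Set.univ.pi fun i => Set.Iio (t i)) ↔ ¬ ∃ i, 1 ≤ (t i)⁻¹ * y i := by
            push Not
            simp only [Set.mem_univ_pi, Set.mem_Iio]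
            exact forall_congr' fun i => (inv_mul_lt_one₀ (ht0 i)).symm
          rw [Set.mem_inter_iff, e1, Set.mem_sdiff, and_comm]
          refine and_congr_left fun hy => ?_
          push Not at hy
          refine exists_congr fun i => ⟨fun h1 => h1.trans ?_, fun h1 => ?_⟩
          · have : 0 ≤ y i := by
              by_contra! hneg
              have := mul_neg_of_pos_of_neg hd' hneg
              simp only at h1
              linarith
            exact mul_le_mul_of_nonneg_right (le_max_left _ _) this
          · rcases max_choice (d : ℝ) (t i)⁻¹ with h2 | h2 <;> rw [h2] at h1
            · exact h1
            · exact absurd h1 (not_le.2 (hy i))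
        have hsub : {y : Fin d → ℝ | ∃ i, 1 ≤ (t i)⁻¹ * y i} ⊆
            {y | ∃ i, 1 ≤ max (d : ℝ) (t i)⁻¹ * y i} := by
          rintro y ⟨i, hi⟩
          refine ⟨i, hi.trans (mul_le_mul_of_nonneg_right (le_max_right _ _) ?_)⟩
          by_contra! hneg
          have := mul_neg_of_pos_of_neg (inv_pos.2 (ht0 i)) hneg
          linarith
        have hxt : ∀ i, 0 ≤ (t i)⁻¹ := fun i => (inv_pos.2 (ht0 i)).le
        have hxm : ∀ i, 0 ≤ max (d : ℝ) (t i)⁻¹ := fun i => hd'.le.trans (le_max_left _ _)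
        rw [Measure.restrict_apply hTm, Measure.restrict_apply hTm, hset,
          measure_sdiff hsub (measurableSet_exists_one_le_mul _).nullMeasurableSet,
          measure_sdiff hsub (measurableSet_exists_one_le_mul _).nullMeasurableSet,
          exponentMeasure_exists_one_le_mul μ hμ hxt, exponentMeasure_exists_one_le_mul μ hμ hxm,
          exponentMeasure_exists_one_le_mul ν hν hxt, exponentMeasure_exists_one_le_mul ν hν hxm,
          h, h]
        · rw [exponentMeasure_exists_one_le_mul ν hν hxt, ← h]
          exact hfin _
        · rw [exponentMeasure_exists_one_le_mul μ hμ hxt]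
          exact hfin _
      · push Not at ht0
        obtain ⟨i, hi⟩ := ht0
        have hsub : (Set.univ.pi fun i => Set.Iio (t i)) ∩ B ⊆ {y | y i < 0} := fun y hy =>
          (hy.1 i (Set.mem_univ i)).trans_le hi
        rw [Measure.restrict_apply hTm, Measure.restrict_apply hTm,
          measure_mono_null hsub (exponentMeasure_apply_lt_zero μ hμ i),
          measure_mono_null hsub (exponentMeasure_apply_lt_zero ν hν i)]
    · rw [Measure.restrict_apply_univ, Measure.restrict_apply_univ, hBμ, hBν, h]
  -- The radial sets lie in `B`, where the exponent measures agree, so `d * μ A = d * ν A`.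
  ext A hA
  have hsub : {y : Fin d → ℝ | 1 < ∑ i, y i ∧ ((d : ℝ) / ∑ i, y i) • y ∈ A} ⊆ B := by
    rintro y ⟨hy, -⟩
    by_contra hc
    simp only [hB, Set.mem_ofPred_eq, not_exists, not_le] at hc
    have h1 : ∑ i, (d : ℝ) * y i ≤ ∑ _i : Fin d, (1 : ℝ) :=
      Finset.sum_le_sum fun i _ => (hc i).le
    rw [← Finset.mul_sum] at h1
    simp only [Finset.sum_const, Finset.card_univ, Fintype.card_fin, nsmul_eq_mul, mul_one] at h1
    nlinarith
  have hμA := exponentMeasure_radial μ hμd hA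
  have hνA := exponentMeasure_radial ν hνd hA
  rw [← Measure.restrict_eq_self _ hsub] at hμA hνA
  rw [hrestr, hνA] at hμA
  exact ((ENNReal.mul_right_inj (by exact_mod_cast hd.ne') (ENNReal.natCast_ne_top d)).1 hμA).symm

/-! ### Integrability and law of generators. -/

namespace IsGenerator

variable {d : ℕ} {N : (Fin d → ℝ) → ℝ} {Ω : Type*} [MeasurableSpace Ω] {P : Measure Ω}
  {Z : Ω → Fin d → ℝ}

lemma integrable_apply (h : IsGenerator N P Z) (i : Fin d) : Integrable (fun ω => Z ω i) P := by
  by_contra hc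
  have := h.expectation_eq_one i
  rw [integral_undef hc] at this
  exact zero_ne_one this

lemma integrable (h : IsGenerator N P Z) : Integrable Z P :=
  Integrable.of_eval h.integrable_apply

lemma lintegral_norm_mul (h : IsGenerator N P Z) (x : Fin d → ℝ) :
    ∫⁻ ω, ENNReal.ofReal ‖x * Z ω‖ ∂P = ENNReal.ofReal (N x) := by
  rw [h.norm_eq x, ofReal_integral_eq_lintegral_ofReal]
  · refine Integrable.norm (Integrable.of_eval fun i => ?_)
    exact (h.integrable_apply i).const_mul (x i)
  · exact ae_of_all _ fun _ => norm_nonneg _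

end IsGenerator

namespace IsNormalizedGenerator

variable {d : ℕ} {N : (Fin d → ℝ) → ℝ} {Ω : Type*} [MeasurableSpace Ω] {P : Measure Ω}
  {Z : Ω → Fin d → ℝ}

/-- Being a normalized generator depends on the law only. -/
lemma of_map_eq (h : IsNormalizedGenerator N P Z) {Ω' : Type*} [MeasurableSpace Ω']
    {P' : Measure Ω'} {Z' : Ω' → Fin d → ℝ} (hZ' : AEMeasurable Z' P')
    (hmap : P'.map Z' = P.map Z) : IsNormalizedGenerator N P' Z' where
  aemeasurable := hZ'
  nonneg := by
    have hs : MeasurableSet {z : Fin d → ℝ | ∀ i, 0 ≤ z i} := by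
      rw [Set.ofPred_forall]
      exact MeasurableSet.iInter fun i => measurableSet_le (by fun_prop) (by fun_prop)
    have := (ae_map_iff h.aemeasurable hs).2 h.nonneg
    rw [← hmap] at this
    exact (ae_map_iff hZ' hs).1 this
  expectation_eq_one i := by
    rw [← h.expectation_eq_one i]
    have hm : StronglyMeasurable fun z : Fin d → ℝ => z i :=
      (measurable_pi_apply i).stronglyMeasurable
    rw [← integral_map hZ' hm.aestronglyMeasurable, hmap,
      integral_map h.aemeasurable hm.aestronglyMeasurable]
  norm_eq x := by
    rw [h.norm_eq x]
    have hm : StronglyMeasurable fun z : Fin d → ℝ => ‖x * z‖ := by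
      refine Continuous.stronglyMeasurable ?_
      fun_prop
    rw [← integral_map h.aemeasurable hm.aestronglyMeasurable, ← hmap,
      integral_map hZ' hm.aestronglyMeasurable]
  l1_eq := by
    have hs : MeasurableSet {z : Fin d → ℝ | ∑ i, |z i| = (d : ℝ)} :=
      measurableSet_eq_fun (by fun_prop) (by fun_prop)
    have := (ae_map_iff h.aemeasurable hs).2 h.l1_eq
    rw [← hmap] at this
    exact (ae_map_iff hZ' hs).1 this

lemma law (h : IsNormalizedGenerator N P Z) : IsNormalizedGenerator N (P.map Z) id :=
  h.of_map_eq aemeasurable_id Measure.map_id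

lemma sum_eq (h : IsNormalizedGenerator N P Z) : ∀ᵐ ω ∂P, ∑ i, Z ω i = (d : ℝ) := by
  filter_upwards [h.nonneg, h.l1_eq] with ω h0 h1
  rw [← h1]
  exact Finset.sum_congr rfl fun i _ => (abs_of_nonneg (h0 i)).symm

/-- The law of a normalized generator is determined by the `D`-norm. -/
theorem map_eq [IsProbabilityMeasure P] (h : IsNormalizedGenerator N P Z) {Ω' : Type*}
    [MeasurableSpace Ω'] {P' : Measure Ω'} [IsProbabilityMeasure P'] {Z' : Ω' → Fin d → ℝ}
    (h' : IsNormalizedGenerator N P' Z') : P.map Z = P'.map Z' := by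
  have := Measure.isProbabilityMeasure_map h.aemeasurable
  have := Measure.isProbabilityMeasure_map h'.aemeasurable
  refine measure_eq_of_lintegral_norm_mul_eq h.law.nonneg h'.law.nonneg h.law.sum_eq h'.law.sum_eq
    (fun x => ?_) (fun x => ?_)
  · exact (h.law.lintegral_norm_mul x).trans_ne ENNReal.ofReal_ne_top
  · exact (h.law.lintegral_norm_mul x).trans (h'.law.lintegral_norm_mul x).symm

lemma norm_le (h : IsNormalizedGenerator N P Z) : ∀ᵐ ω ∂P, ‖Z ω‖ ≤ d := by
  filter_upwards [h.l1_eq] with ω h1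
  rw [pi_norm_le_iff_of_nonneg (Nat.cast_nonneg d)]
  intro i
  rw [← h1, Real.norm_eq_abs]
  exact Finset.single_le_sum (f := fun i => |Z ω i|) (fun j _ => abs_nonneg _) (Finset.mem_univ i)

end IsNormalizedGenerator

/-! ### Couplings of weakly close measures. -/

open scoped ENNReal NNReal BoundedContinuousFunction

namespace MeasureTheory

variable {E : Type*} [MeasurableSpace E]

/-- Two finite measures of the same mass admit a coupling. -/
lemma exists_fst_eq_snd_eq (α β : Measure E) [IsFiniteMeasure α] [IsFiniteMeasure β]
    (h : α Set.univ = β Set.univ) : ∃ γ : Measure (E × E), γ.fst = α ∧ γ.snd = β := by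
  by_cases h0 : α Set.univ = 0
  · have hα : α = 0 := Measure.measure_univ_eq_zero.1 h0
    have hβ : β = 0 := Measure.measure_univ_eq_zero.1 (h ▸ h0)
    exact ⟨0, by simp [hα], by simp [hβ]⟩
  · refine ⟨(α Set.univ)⁻¹ • α.prod β, ?_, ?_⟩
    · rw [Measure.fst, Measure.map_smul, Measure.map_fst_prod, smul_smul, ← h,
        ENNReal.inv_mul_cancel h0 (measure_ne_top _ _), one_smul]
    · rw [Measure.snd, Measure.map_smul, Measure.map_snd_prod, smul_smul,
        ENNReal.inv_mul_cancel h0 (measure_ne_top _ _), one_smul]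

/-- A part of prescribed mass can be split off from a finite measure. -/
lemma exists_add_eq_measure_univ_eq (α : Measure E) [IsFiniteMeasure α] {c : ℝ≥0∞}
    (hc : c ≤ α Set.univ) : ∃ α₁ α₂ : Measure E, α₁ + α₂ = α ∧ α₁ Set.univ = c := by
  by_cases h0 : α Set.univ = 0
  · exact ⟨0, α, zero_add _, by rw [h0] at hc; simpa using (le_antisymm hc bot_le).symm⟩
  · refine ⟨(c / α Set.univ) • α, (1 - c / α Set.univ) • α, ?_, ?_⟩
    · rw [← add_smul, add_tsub_cancel_of_le (ENNReal.div_le_of_le_mul (by rwa [one_mul])),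
        one_smul]
    · rw [Measure.smul_apply, smul_eq_mul, ENNReal.div_mul_cancel h0 (measure_ne_top _ _)]

/-- Two finite sums of measures with the same total mass admit a coupling which couples as much
mass as possible within corresponding summands. -/
lemma exists_coupling_sum {ι : Type*} [Fintype ι] (α β : ι → Measure E)
    [∀ i, IsFiniteMeasure (α i)] [∀ i, IsFiniteMeasure (β i)]
    (h : (∑ i, α i) Set.univ = (∑ i, β i) Set.univ) :
    ∃ (γ : ι → Measure (E × E)) (ρ : Measure (E × E)),
      (∑ i, γ i + ρ).fst = ∑ i, α i ∧ (∑ i, γ i + ρ).snd = ∑ i, β i ∧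
      (∀ i, (γ i).fst ≤ α i) ∧ (∀ i, (γ i).snd ≤ β i) ∧
      ρ Set.univ = ∑ i, (α i Set.univ - β i Set.univ) := by
  -- From each pair, parts of the common mass `min (α i univ) (β i univ)` are split off and coupled;
  -- the remainders have equal total mass and are coupled by `ρ`.
  choose α₁ α₂ hα hα₁ using fun i => exists_add_eq_measure_univ_eq (α i)
    (min_le_left (α i Set.univ) (β i Set.univ))
  choose β₁ β₂ hβ hβ₁ using fun i => exists_add_eq_measure_univ_eq (β i)
    (min_le_right (α i Set.univ) (β i Set.univ))
  have hα₁le : ∀ i, α₁ i ≤ α i := fun i => by rw [← hα i]; exact Measure.le_add_right le_rfl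
  have hα₂le : ∀ i, α₂ i ≤ α i := fun i => by rw [← hα i]; exact Measure.le_add_left le_rfl
  have hβ₁le : ∀ i, β₁ i ≤ β i := fun i => by rw [← hβ i]; exact Measure.le_add_right le_rfl
  have hβ₂le : ∀ i, β₂ i ≤ β i := fun i => by rw [← hβ i]; exact Measure.le_add_left le_rfl
  have := fun i => isFiniteMeasure_of_le (α i) (hα₁le i)
  have := fun i => isFiniteMeasure_of_le (α i) (hα₂le i)
  have := fun i => isFiniteMeasure_of_le (β i) (hβ₁le i)
  have := fun i => isFiniteMeasure_of_le (β i) (hβ₂le i)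
  choose γ hγ₁ hγ₂ using fun i => exists_fst_eq_snd_eq (α₁ i) (β₁ i) ((hα₁ i).trans (hβ₁ i).symm)
  have hαs : ∑ i, α i = ∑ i, α₁ i + ∑ i, α₂ i := by
    rw [← Finset.sum_add_distrib]
    exact Finset.sum_congr rfl fun i _ => (hα i).symm
  have hβs : ∑ i, β i = ∑ i, β₁ i + ∑ i, β₂ i := by
    rw [← Finset.sum_add_distrib]
    exact Finset.sum_congr rfl fun i _ => (hβ i).symm
  have hm : (∑ i, α₁ i) Set.univ = (∑ i, β₁ i) Set.univ := by
    simp only [Measure.coe_finsetSum, Finset.sum_apply, hα₁, hβ₁]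
  obtain ⟨ρ, hρ₁, hρ₂⟩ := exists_fst_eq_snd_eq (∑ i, α₂ i) (∑ i, β₂ i) (by
    rw [hαs, hβs, Measure.add_apply, Measure.add_apply, hm] at h
    exact (ENNReal.add_right_inj (measure_ne_top _ _)).1 h)
  refine ⟨γ, ρ, ?_, ?_, fun i => (hγ₁ i).trans_le (hα₁le i), fun i => (hγ₂ i).trans_le (hβ₁le i),
    ?_⟩
  · rw [Measure.fst_add, hρ₁, hαs, Measure.fst, ← Measure.mapₗ_apply_of_measurable measurable_fst,
      map_sum]
    congr 1
    refine Finset.sum_congr rfl fun i _ => ?_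
    rw [Measure.mapₗ_apply_of_measurable measurable_fst, ← hγ₁ i, Measure.fst]
  · rw [Measure.snd_add, hρ₂, hβs, Measure.snd, ← Measure.mapₗ_apply_of_measurable measurable_snd,
      map_sum]
    congr 1
    refine Finset.sum_congr rfl fun i _ => ?_
    rw [Measure.mapₗ_apply_of_measurable measurable_snd, ← hγ₂ i, Measure.snd]
  · rw [← Measure.fst_univ, hρ₁, Measure.coe_finsetSum, Finset.sum_apply]
    refine Finset.sum_congr rfl fun i _ => ?_
    have h1 : α i Set.univ = α₁ i Set.univ + α₂ i Set.univ := by rw [← hα i]; rfl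
    rw [← tsub_min, ← hα₁ i]
    conv_rhs => rw [h1]
    rw [ENNReal.add_sub_cancel_left (measure_ne_top _ _)]

/-- A partition of unity on a compact set, subordinate to balls of a given radius. -/
lemma _root_.IsCompact.exists_bounded_partition_of_unity {X : Type*} [PseudoMetricSpace X]
    {K : Set X} (hK : IsCompact K) {ε : ℝ} (hε : 0 < ε) :
    ∃ (t : Finset X) (φ : t → X →ᵇ ℝ≥0),
      (∀ i x, φ i x ≠ 0 → dist x i ≤ ε) ∧ ∀ x ∈ K, ∑ i, φ i x = 1 := by
  have hε2 : 0 < ε / 2 := half_pos hε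
  obtain ⟨t, -, htf, hcov⟩ := hK.finite_cover_balls hε2
  lift t to Finset X using htf
  let g : t → X →ᵇ ℝ≥0 := fun i => thickenedIndicator hε2 (Metric.ball (i : X) (ε / 2))
  -- The maximum with 1 keeps the denominator nonzero off `K`; on `K` some `g i` equals 1, so `G` is
  -- the sum itself.
  let G : X → ℝ≥0 := fun x => max (∑ i, g i x) 1
  have hG0 : ∀ x, G x ≠ 0 := fun x => (zero_lt_one.trans_le (le_max_right _ _)).ne'
  have hGc : Continuous G := by fun_prop
  have hle : ∀ i x, g i x / G x ≤ 1 := fun i x =>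
    div_le_one_of_le₀ ((Finset.single_le_sum (f := fun j => g j x) (fun _ _ => bot_le)
      (Finset.mem_univ i)).trans (le_max_left _ _)) bot_le
  refine ⟨t, fun i => BoundedContinuousFunction.mkOfBound
    ⟨fun x => g i x / G x, (g i).continuous.div₀ hGc hG0⟩ 1 fun x y => ?_, fun i x hx => ?_,
    fun x hx => ?_⟩
  · rw [NNReal.dist_eq]
    have h1 : ((g i x / G x : ℝ≥0) : ℝ) ≤ 1 := by exact_mod_cast hle i x
    have h2 : ((g i y / G y : ℝ≥0) : ℝ) ≤ 1 := by exact_mod_cast hle i y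
    have h3 := (g i x / G x : ℝ≥0).coe_nonneg
    have h4 := (g i y / G y : ℝ≥0).coe_nonneg
    exact abs_sub_le_iff.2 ⟨by simp only [ContinuousMap.coe_mk]; linarith,
      by simp only [ContinuousMap.coe_mk]; linarith⟩
  · contrapose! hx
    have : g i x = 0 := by
      refine thickenedIndicator_zero hε2 _ fun hmem => ?_
      obtain ⟨y, hy, hxy⟩ := Metric.mem_thickening_iff.1 hmem
      have := dist_triangle x y i
      rw [Metric.mem_ball] at hy
      linarith
    change g i x / G x = 0
    rw [this, zero_div]
  · change ∑ i, g i x / G x = 1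
    rw [← Finset.sum_div]
    have hmem := hcov hx
    simp only [Set.mem_iUnion, exists_prop] at hmem
    obtain ⟨c, hc, hxc⟩ := hmem
    have h1 : g ⟨c, hc⟩ x = 1 :=
      thickenedIndicator_one hε2 _ hxc
    have h2 : 1 ≤ ∑ i, g i x := h1 ▸ Finset.single_le_sum (f := fun j => g j x)
      (fun _ _ => bot_le) (Finset.mem_univ _)
    have h3 : G x = ∑ i, g i x := max_eq_left h2
    rw [h3]
    exact div_self (zero_lt_one.trans_le h2).ne'

lemma sum_withDensity_eq {ι : Type*} [Fintype ι] (μ : Measure E) {f : ι → E → ℝ≥0∞}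
    (hf : ∀ i, Measurable (f i)) (h : ∀ᵐ x ∂μ, ∑ i, f i x = 1) :
    ∑ i, μ.withDensity (f i) = μ := by
  ext s hs
  rw [Measure.coe_finsetSum, Finset.sum_apply]
  simp only [withDensity_apply _ hs]
  rw [← lintegral_finsetSum _ fun i _ => hf i, lintegral_congr_ae (ae_restrict_of_ae h),
    setLIntegral_one]

/-- On a compact set, weakly close probability measures admit a coupling with a small expected
distance. -/
theorem exists_coupling_lintegral_edist_le [PseudoMetricSpace E] [OpensMeasurableSpace E]
    {ι : Type*} {F : Filter ι} {μs : ι → ProbabilityMeasure E} {μ : ProbabilityMeasure E}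
    (hμs : Tendsto μs F (𝓝 μ)) {K : Set E} (hK : IsCompact K)
    (hsK : ∀ i, ∀ᵐ x ∂(μs i : Measure E), x ∈ K) (hμK : ∀ᵐ x ∂(μ : Measure E), x ∈ K)
    {ε : ℝ} (hε : 0 < ε) :
    ∀ᶠ i in F, ∃ γ : Measure (E × E), γ.fst = μs i ∧ γ.snd = μ ∧
      ∫⁻ p, edist p.1 p.2 ∂γ ≤ ENNReal.ofReal ε := by
  -- Radius `ε / 4` puts two points of one piece within `ε / 2`; the other `ε / 2` pays for the
  -- leftover mass.
  obtain ⟨t, φ, hφd, hφ1⟩ := hK.exists_bounded_partition_of_unity (by positivity : 0 < ε / 4)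
  have hφm : ∀ j, Measurable fun x => (φ j x : ℝ≥0∞) := fun j =>
    (φ j).continuous.measurable.coe_nnreal_ennreal
  have hφE : ∀ x ∈ K, ∑ j, (φ j x : ℝ≥0∞) = 1 := fun x hx => by exact_mod_cast hφ1 x hx
  have hlim : ∀ j, Tendsto (fun i => ∫⁻ x, φ j x ∂(μs i : Measure E)) F
      (𝓝 (∫⁻ x, φ j x ∂(μ : Measure E))) := fun j =>
    ProbabilityMeasure.tendsto_iff_forall_lintegral_tendsto.1 hμs (φ j)
  have hfin : ∀ j (ν : ProbabilityMeasure E), ∫⁻ x, φ j x ∂(ν : Measure E) ≠ ⊤ := fun j ν =>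
    ((φ j).lintegral_lt_top_of_nnreal (ν : Measure E)).ne
  have hres : Tendsto (fun i => Metric.ediam K * ∑ j, ((∫⁻ x, φ j x ∂(μs i : Measure E)) -
      ∫⁻ x, φ j x ∂(μ : Measure E))) F (𝓝 0) := by
    have h1 : Tendsto (fun i => ∑ j, ((∫⁻ x, φ j x ∂(μs i : Measure E)) -
      ∫⁻ x, φ j x ∂(μ : Measure E))) F (𝓝 (∑ j : t, 0)) := by
      refine tendsto_finsetSum _ fun j _ => ?_
      have := ENNReal.Tendsto.sub (hlim j) (tendsto_const_nhds (x := ∫⁻ x, φ j x ∂(μ : Measure E)))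
        (Or.inl (hfin j μ))
      rwa [tsub_self] at this
    have h2 := ENNReal.Tendsto.const_mul h1 (Or.inr hK.isBounded.ediam_ne_top)
    simpa using h2
  have hε2 : 0 < ENNReal.ofReal (ε / 2) := by simpa using hε
  filter_upwards [hres.eventually_le_const hε2] with i hi
  have hs := sum_withDensity_eq (μs i : Measure E) hφm ((hsK i).mono hφE)
  have hs0 := sum_withDensity_eq (μ : Measure E) hφm (hμK.mono hφE)
  have := fun j => isFiniteMeasure_withDensity (hfin j (μs i))
  have := fun j => isFiniteMeasure_withDensity (hfin j μ)
  obtain ⟨γ, ρ, h1, h2, hγ1, hγ2, hρ⟩ := exists_coupling_sum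
    (fun j => (μs i : Measure E).withDensity fun x => (φ j x : ℝ≥0∞))
    (fun j => (μ : Measure E).withDensity fun x => (φ j x : ℝ≥0∞))
    (by rw [hs, hs0, measure_univ, measure_univ])
  refine ⟨∑ j, γ j + ρ, h1.trans hs, h2.trans hs0, ?_⟩
  have hball : ∀ j : t, ∀ ν : Measure E,
      ∀ᵐ x ∂(ν.withDensity fun x => (φ j x : ℝ≥0∞)), dist x (j : E) ≤ ε / 4 := fun j ν => by
    rw [ae_withDensity_iff (hφm j)]
    exact ae_of_all _ fun x hx => hφd j x (by simpa using hx)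
  have hγ : ∀ j, ∫⁻ p, edist p.1 p.2 ∂(γ j) ≤
      ENNReal.ofReal (ε / 2) * ∫⁻ x, φ j x ∂(μs i : Measure E) := fun j => by
    have a1 : ∀ᵐ p ∂(γ j), dist p.1 (j : E) ≤ ε / 4 :=
      ae_of_ae_map measurable_fst.aemeasurable
        ((Measure.absolutelyContinuous_of_le (hγ1 j)).ae_le (hball j _))
    have a2 : ∀ᵐ p ∂(γ j), dist p.2 (j : E) ≤ ε / 4 :=
      ae_of_ae_map measurable_snd.aemeasurable
        ((Measure.absolutelyContinuous_of_le (hγ2 j)).ae_le (hball j _))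
    calc ∫⁻ p, edist p.1 p.2 ∂(γ j) ≤ ∫⁻ _, ENNReal.ofReal (ε / 2) ∂(γ j) := by
          refine lintegral_mono_ae ?_
          filter_upwards [a1, a2] with p hp1 hp2
          rw [edist_dist]
          refine ENNReal.ofReal_le_ofReal ?_
          have := dist_triangle_right p.1 p.2 j
          linarith
      _ = ENNReal.ofReal (ε / 2) * (γ j).fst Set.univ := by
          rw [lintegral_const, Measure.fst_univ]
      _ ≤ _ := by
          gcongr
          refine (hγ1 j Set.univ).trans_eq ?_
          rw [withDensity_apply _ MeasurableSet.univ, Measure.restrict_univ]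
  have hρK : ∫⁻ p, edist p.1 p.2 ∂ρ ≤ Metric.ediam K * ρ Set.univ := by
    -- `ρ` is dominated by the whole coupling, whose marginals live on `K`.
    have hle : ρ ≤ ∑ j, γ j + ρ := Measure.le_add_left le_rfl
    have a1 : ∀ᵐ p ∂ρ, p.1 ∈ K := by
      refine (Measure.absolutelyContinuous_of_le hle).ae_le
        (ae_of_ae_map measurable_fst.aemeasurable ?_)
      have := hsK i
      rwa [← hs, ← h1] at this
    have a2 : ∀ᵐ p ∂ρ, p.2 ∈ K := by
      refine (Measure.absolutelyContinuous_of_le hle).ae_le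
        (ae_of_ae_map measurable_snd.aemeasurable ?_)
      have := hμK
      rwa [← hs0, ← h2] at this
    rw [← lintegral_const]
    refine lintegral_mono_ae ?_
    filter_upwards [a1, a2] with p hp1 hp2
    exact Metric.edist_le_ediam_of_mem hp1 hp2
  have hsum : ∑ j, ∫⁻ x, φ j x ∂(μs i : Measure E) = 1 := by
    rw [← lintegral_finsetSum _ fun j _ => hφm j, lintegral_congr_ae ((hsK i).mono hφE)]
    simp
  have hρ' : ρ Set.univ = ∑ j, ((∫⁻ x, φ j x ∂(μs i : Measure E)) -
      ∫⁻ x, φ j x ∂(μ : Measure E)) := by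
    rw [hρ]
    simp only [withDensity_apply _ MeasurableSet.univ, Measure.restrict_univ]
  rw [lintegral_add_measure, lintegral_finsetSum_measure]
  calc ∑ j, ∫⁻ p, edist p.1 p.2 ∂(γ j) + ∫⁻ p, edist p.1 p.2 ∂ρ
      ≤ ∑ j, ENNReal.ofReal (ε / 2) * ∫⁻ x, φ j x ∂(μs i : Measure E)
        + ENNReal.ofReal (ε / 2) :=
        add_le_add (Finset.sum_le_sum fun j _ => hγ j) (hρK.trans (hρ' ▸ hi))
    _ = ENNReal.ofReal ε := by
        rw [← Finset.mul_sum, hsum, mul_one, ← ENNReal.ofReal_add (by positivity) (by positivity),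
          add_halves]

end MeasureTheory

/-! ### Bounds for `dW` by couplings and Lipschitz test functions. -/

namespace DNorm

variable {d : ℕ}

lemma dW_nonneg (N₁ N₂ : DNorm d) : 0 ≤ dW N₁ N₂ := by
  refine Real.sInf_nonneg ?_
  rintro r ⟨Ω, _, P, _, Z₁, Z₂, -, -, rfl⟩
  exact integral_nonneg fun ω => Finset.sum_nonneg fun i _ => abs_nonneg _

lemma dW_le {N₁ N₂ : DNorm d} {Ω : Type} [MeasurableSpace Ω] {P : Measure Ω}
    [IsProbabilityMeasure P] {Z₁ Z₂ : Ω → Fin d → ℝ}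
    (h₁ : IsNormalizedGenerator N₁.toSeminorm P Z₁)
    (h₂ : IsNormalizedGenerator N₂.toSeminorm P Z₂) :
    dW N₁ N₂ ≤ ∫ ω, ∑ i, |Z₁ ω i - Z₂ ω i| ∂P := by
  refine csInf_le ⟨0, ?_⟩ ⟨Ω, _, P, inferInstance, Z₁, Z₂, h₁, h₂, rfl⟩
  rintro r ⟨Ω, _, P, _, Z₁, Z₂, -, -, rfl⟩
  exact integral_nonneg fun ω => Finset.sum_nonneg fun i _ => abs_nonneg _

end DNorm

lemma norm_sub_le_sum_abs {d : ℕ} (x y : Fin d → ℝ) : ‖x - y‖ ≤ ∑ i, |x i - y i| := by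
  rw [pi_norm_le_iff_of_nonneg (Finset.sum_nonneg fun i _ => abs_nonneg _)]
  exact fun i => Finset.single_le_sum (f := fun i => |x i - y i|) (fun j _ => abs_nonneg _)
    (Finset.mem_univ i)

lemma sum_abs_sub_le {d : ℕ} (x y : Fin d → ℝ) : ∑ i, |x i - y i| ≤ d * dist x y := by
  calc ∑ i, |x i - y i| ≤ ∑ _i : Fin d, dist x y :=
        Finset.sum_le_sum fun i _ => by
          rw [← Real.dist_eq]
          exact dist_le_pi_dist x y i
    _ = d * dist x y := by simp

lemma IsGenerator.integrable_comp_of_lipschitzWith {d : ℕ} {N : (Fin d → ℝ) → ℝ} {Ω : Type*}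
    [MeasurableSpace Ω] {P : Measure Ω} [IsFiniteMeasure P] {Z : Ω → Fin d → ℝ}
    (h : IsGenerator N P Z) {f : (Fin d → ℝ) → ℝ} {L : NNReal} (hf : LipschitzWith L f) :
    Integrable (fun ω => f (Z ω)) P := by
  refine Integrable.mono' ((integrable_const |f 0|).add (h.integrable.norm.const_mul (L : ℝ)))
    (hf.continuous.measurable.comp_aemeasurable h.aemeasurable).aestronglyMeasurable
    (ae_of_all _ fun ω => ?_)
  have h1 := hf.dist_le_mul (Z ω) 0
  rw [Real.dist_eq, dist_zero_right] at h1
  have h2 := abs_sub_abs_le_abs_sub (f (Z ω)) (f 0)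
  simp only [Pi.add_apply, Real.norm_eq_abs]
  linarith

namespace IsNormalizedGenerator

variable {d : ℕ} {N₁ N₂ : DNorm d} {Ω₁ Ω₂ : Type*} [MeasurableSpace Ω₁] [MeasurableSpace Ω₂]
  {P₁ : Measure Ω₁} {P₂ : Measure Ω₂} [IsProbabilityMeasure P₁]
  {Z₁ : Ω₁ → Fin d → ℝ} {Z₂ : Ω₂ → Fin d → ℝ}

/-- A coupling of the laws of two normalized generators bounds the distance of the `D`-norms. -/
lemma dW_le_of_coupling (h₁ : IsNormalizedGenerator N₁.toSeminorm P₁ Z₁)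
    (h₂ : IsNormalizedGenerator N₂.toSeminorm P₂ Z₂)
    {γ : Measure ((Fin d → ℝ) × (Fin d → ℝ))} (hγ₁ : γ.fst = P₁.map Z₁) (hγ₂ : γ.snd = P₂.map Z₂) :
    DNorm.dW N₁ N₂ ≤ ∫ p, ∑ i, |p.1 i - p.2 i| ∂γ := by
  have : IsProbabilityMeasure γ := by
    have := Measure.isProbabilityMeasure_map h₁.aemeasurable
    refine ⟨?_⟩
    rw [← Measure.fst_univ, hγ₁, measure_univ]
  exact DNorm.dW_le (h₁.of_map_eq measurable_fst.aemeasurable hγ₁)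
    (h₂.of_map_eq measurable_snd.aemeasurable hγ₂)

/-- The expectations of a Lipschitz function under two normalized generators differ by at most
the Lipschitz constant times the distance of the `D`-norms. -/
lemma abs_integral_sub_le [IsProbabilityMeasure P₂]
    (h₁ : IsNormalizedGenerator N₁.toSeminorm P₁ Z₁)
    (h₂ : IsNormalizedGenerator N₂.toSeminorm P₂ Z₂) {f : (Fin d → ℝ) → ℝ} {L : NNReal}
    (hf : LipschitzWith L f) :
    |∫ z, f z ∂(P₁.map Z₁) - ∫ z, f z ∂(P₂.map Z₂)| ≤ L * DNorm.dW N₁ N₂ := by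
  have := Measure.isProbabilityMeasure_map h₁.aemeasurable
  have := Measure.isProbabilityMeasure_map h₂.aemeasurable
  -- The independent coupling is admissible, so the infimum is not the default value 0 of `sInf ∅`.
  have hne : {r : ℝ | ∃ (Ω : Type) (_ : MeasurableSpace Ω) (P : Measure Ω)
      (_ : IsProbabilityMeasure P) (Z₁ Z₂ : Ω → Fin d → ℝ),
      IsNormalizedGenerator N₁.toSeminorm P Z₁ ∧ IsNormalizedGenerator N₂.toSeminorm P Z₂ ∧
      r = ∫ ω, ∑ i, |Z₁ ω i - Z₂ ω i| ∂P}.Nonempty :=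
    ⟨_, (Fin d → ℝ) × (Fin d → ℝ), inferInstance, (P₁.map Z₁).prod (P₂.map Z₂), inferInstance,
      Prod.fst, Prod.snd,
      h₁.of_map_eq measurable_fst.aemeasurable (Measure.fst_prod (ν := P₂.map Z₂)),
      h₂.of_map_eq measurable_snd.aemeasurable (Measure.snd_prod (μ := P₁.map Z₁)), rfl⟩
  rw [DNorm.dW, ← smul_eq_mul (L : ℝ), ← Real.sInf_smul_of_nonneg L.coe_nonneg]
  refine le_csInf hne.smul_set ?_
  rintro _ ⟨_, ⟨Ω, _, P, _, X, Y, hX, hY, rfl⟩, rfl⟩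
  have hfX : Integrable (fun ω => f (X ω)) P := hX.integrable_comp_of_lipschitzWith hf
  have hfY : Integrable (fun ω => f (Y ω)) P := hY.integrable_comp_of_lipschitzWith hf
  have hXY : Integrable (fun ω => ∑ i, |X ω i - Y ω i|) P :=
    integrable_finsetSum _ fun i _ => ((hX.integrable_apply i).sub (hY.integrable_apply i)).abs
  -- Uniqueness of the law enters here: the competitors `X`, `Y` have the laws of `Z₁`, `Z₂`.
  rw [h₁.map_eq hX, h₂.map_eq hY,
    integral_map hX.aemeasurable hf.continuous.stronglyMeasurable.aestronglyMeasurable,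
    integral_map hY.aemeasurable hf.continuous.stronglyMeasurable.aestronglyMeasurable,
    ← integral_sub hfX hfY]
  refine abs_integral_le_integral_abs.trans ?_
  simp only [smul_eq_mul]
  rw [← integral_const_mul]
  refine integral_mono (hfX.sub hfY).abs (hXY.const_mul _) fun ω => ?_
  have h3 := hf.dist_le_mul (X ω) (Y ω)
  rw [Real.dist_eq, dist_eq_norm] at h3
  exact h3.trans (mul_le_mul_of_nonneg_left (norm_sub_le_sum_abs _ _) L.coe_nonneg)

end IsNormalizedGenerator

/-! ### The equivalence. -/

theorem mainTheorem6 (d : ℕ) (D : ℕ → DNorm d)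
    (Ω : ℕ → Type*) [∀ n, MeasurableSpace (Ω n)]
    (P : ∀ n, Measure (Ω n)) [∀ n, IsProbabilityMeasure (P n)]
    (Z : ∀ n, Ω n → Fin d → ℝ)
    (hZ : ∀ n, IsNormalizedGenerator (D n).toSeminorm (P n) (Z n)) :
    Tendsto (fun n => DNorm.dW (D n) (D 0)) atTop (𝓝 0) ↔
      TendstoInDistribution Z atTop (Z 0) P (P 0) := by
  constructor
  · intro h
    refine ⟨fun n => (hZ n).aemeasurable, (hZ 0).aemeasurable, ?_⟩
    refine tendsto_iff_forall_lipschitz_integral_tendsto.2 ?_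
    rintro f - ⟨L, hf⟩
    rw [tendsto_iff_dist_tendsto_zero]
    refine squeeze_zero (fun _ => dist_nonneg)
      (fun n => (hZ n).abs_integral_sub_le (hZ 0) hf) ?_
    simpa using h.const_mul (L : ℝ)
  · intro h
    have hK : ∀ n, ∀ᵐ z ∂((P n).map (Z n)), z ∈ Metric.closedBall (0 : Fin d → ℝ) d := fun n => by
      filter_upwards [(hZ n).law.norm_le] with z hz
      simpa using hz
    rw [Metric.tendsto_atTop']
    intro ε hε
    -- The ℓ¹ cost is at most `d` times the sup distance; dividing by `d + 1` gives a strict bound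
    -- and covers `d = 0`.
    have hd : (0 : ℝ) < d + 1 := by positivity
    have hev := exists_coupling_lintegral_edist_le h.tendsto
      (isCompact_closedBall (0 : Fin d → ℝ) d) hK (hK 0) (div_pos hε hd)
    obtain ⟨n₀, hn₀⟩ := eventually_atTop.1 hev
    refine ⟨n₀, fun n hn => ?_⟩
    obtain ⟨γ, h1, h2, h3⟩ := hn₀ n hn.le
    rw [Real.dist_eq, sub_zero, abs_of_nonneg (DNorm.dW_nonneg _ _)]
    refine ((hZ n).dW_le_of_coupling (hZ 0) h1 h2).trans_lt ?_
    have h4 : ∫ p, dist p.1 p.2 ∂γ ≤ ε / (d + 1) := by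
      rw [integral_eq_lintegral_of_nonneg_ae (ae_of_all _ fun _ => dist_nonneg)
        continuous_dist.stronglyMeasurable.aestronglyMeasurable]
      simp only [← edist_dist]
      exact ENNReal.toReal_le_of_le_ofReal (div_pos hε hd).le h3
    have hint : Integrable (fun p : (Fin d → ℝ) × (Fin d → ℝ) => dist p.1 p.2) γ := by
      refine ⟨continuous_dist.stronglyMeasurable.aestronglyMeasurable, ?_⟩
      rw [hasFiniteIntegral_iff_ofReal (ae_of_all _ fun _ => dist_nonneg)]
      simp only [← edist_dist]
      exact h3.trans_lt ENNReal.ofReal_lt_top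
    calc ∫ p, ∑ i, |p.1 i - p.2 i| ∂γ ≤ ∫ p, d * dist p.1 p.2 ∂γ :=
          integral_mono_of_nonneg
            (ae_of_all _ fun _ => Finset.sum_nonneg fun i _ => abs_nonneg _) (hint.const_mul _)
            (ae_of_all _ fun p => sum_abs_sub_le p.1 p.2)
      _ = d * ∫ p, dist p.1 p.2 ∂γ := integral_const_mul _ _
      _ ≤ d * (ε / (d + 1)) := by gcongr
      _ < ε := by
          rw [mul_div_assoc', div_lt_iff₀ hd]
          nlinarith
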